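/- Let $d\in\{2,3\}$, $m\ge 0$, $L>0$, and let $\Gamma$ be a rectifiable curve of length $L$ in $\mathbb R^d$, parametrized by arc length by $\gamma:[0,L]\to\mathbb R^d$ (it may be closed, and need not be simple). For a force density $f\in L^1([0,L];\mathbb C^m)$ let $\delta_\Gamma$ be the line distribution of forces $$\langle\delta_\Gamma,\varphi\rangle=\int_0^L\varphi(\gamma(t))\,f(t)\,dt ,$$ so that $f\equiv 1$, $m=1$, is the uniform distribution along $\Gamma$. Given points $x_i=\gamma(t_i)$ with $t_i\in[(i-1)L/N,\,iL/N]$, $1\le i\le N$ (one point in each of the $N$ consecutive arcs of length $L/N$), and vectors $c_i\in\mathbb C^m$, let $\sum_{i=1}^N c_i\delta_i$ denote $\varphi\mapsto\sum_{i=1}^N\varphi(x_i)\,c_i$. Here $H^{\sigma}=H^{\sigma}(\mathbb R^d;\mathbb C^m)$ with norm $\|(1+|\xi|^2)^{\sigma/2}\hat T\|_{L^2}$. Consider the two choices of forces (a) $c_i=\int_{(i-1)L/N}^{iL/N}f(t)\,dt$; (b) $c_i=\frac{L}{N}f(t_i)$, for $f$ continuous on $[0,L]$ (both give $c_i=L/N$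 when $f\equiv1$). Then for every $s>0$: 1. In case (a) for every $f\in L^1([0,L];\mathbb C^m)$, and in case (b) for every continuous $f$, for every choice of such points for each $N$, the distributions $\delta_\Gamma$ and $\sum_{i=1}^N c_i\delta_i$ belong to $H^{-3/2-s}$ and $\sum_{i=1}^N c_i\delta_i\to\delta_\Gamma$ weakly in $H^{-3/2-s}$ as $N\to\infty$. 2. In case (a) for every $f\in L^1([0,L];\mathbb C^m)$, and in case (b) for every Lipschitz $f$, there is a constant $C$, depending on $\gamma,f,s$ but not on $N$ or on the choice of the points, such that for all $N\ge1$ and all such points $$\Big\|\delta_\Gamma-\sum_{i=1}^N c_i\delta_i\Big\|_{H^{-2-s}}\le\frac{C}{\sqrt N}\qquad\text{and}\qquad\Big\|\delta_\Gamma-\sum_{i=1}^N c_i\delta_i\Big\|_{H^{-5/2-s}}\le\frac{C}{N}.$$ -/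

import Mathlib

open MeasureTheory Filter Topology Set
open scoped ENNReal SchwartzMap

noncomputable section

namespace LineForce

/-! ### Sobolev norms and weak convergence in `H^σ(ℝ^d)` -/

section Sobolev

variable {E F : Type*} [NormedAddCommGroup E] [InnerProductSpace ℝ E] [FiniteDimensional ℝ E]
  [MeasurableSpace E] [BorelSpace E]
  [NormedAddCommGroup F] [InnerProductSpace ℂ F] [CompleteSpace F]

/-- The norm of a tempered distribution `T` in the Sobolev space `H^σ(E; F)`: the `L²` norm of the
Bessel potential `𝓕⁻¹ (1 + |ξ|²)^(σ/2) 𝓕 T`, and `∞` if that distribution is not an `L²` function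
(that is, if `T` is not in `H^σ`). -/
def sobolevENorm (σ : ℝ) (T : 𝓢'(E, F)) : ℝ≥0∞ :=
  ⨅ (u : Lp F 2 (volume : Measure E))
    (_ : TemperedDistribution.besselPotential E F σ T = (u : 𝓢'(E, F))), ‖u‖ₑ

/-- The infimum in `sobolevENorm` runs over at most one element. -/
theorem sobolevENorm_eq {σ : ℝ} {T : 𝓢'(E, F)} {u : Lp F 2 (volume : Measure E)}
    (hu : TemperedDistribution.besselPotential E F σ T = (u : 𝓢'(E, F))) :
    sobolevENorm σ T = ‖u‖ₑ := by
  refine le_antisymm (iInf₂_le u hu) (le_iInf₂ fun v hv => ?_)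
  have hinj : Function.Injective (Lp.toTemperedDistributionCLM F (volume : Measure E) 2) :=
    LinearMap.ker_eq_bot.mp (Lp.ker_toTemperedDistributionCLM_eq_bot)
  have huv : u = v := hinj (by simpa using hu.symm.trans hv)
  rw [huv]

theorem sobolevENorm_lt_top_iff {σ : ℝ} {T : 𝓢'(E, F)} :
    sobolevENorm σ T < ∞ ↔ TemperedDistribution.MemSobolev σ 2 T := by
  constructor
  · intro h
    obtain ⟨u, hu⟩ := iInf_lt_iff.mp h
    obtain ⟨hu, -⟩ := iInf_lt_iff.mp hu
    exact ⟨u, hu⟩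
  · rintro ⟨u, hu⟩
    rw [sobolevENorm_eq hu]
    exact enorm_lt_top

/-- Weak convergence of the sequence `T` to `S` in `H^σ(E; F)`. The Bessel potential of order `σ` is
an isometry of `H^σ` onto `L²`, so every continuous linear functional on `H^σ` is the composition of
the Bessel potential with a continuous linear functional `ℓ` on `L²`. In particular all `T N` and `S`
are required to lie in `H^σ`. -/
def TendstoWeaklySobolev (σ : ℝ) (T : ℕ → 𝓢'(E, F)) (S : 𝓢'(E, F)) : Prop :=
  ∃ (u : ℕ → Lp F 2 (volume : Measure E)) (v : Lp F 2 (volume : Measure E)),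
    (∀ N, TemperedDistribution.besselPotential E F σ (T N) = (u N : 𝓢'(E, F))) ∧
    TemperedDistribution.besselPotential E F σ S = (v : 𝓢'(E, F)) ∧
    ∀ ℓ : StrongDual ℂ (Lp F 2 (volume : Measure E)),
      Tendsto (fun N => ℓ (u N)) atTop (𝓝 (ℓ v))

end Sobolev

/-! ### Point forces and line forces -/

section Forces

variable {E F : Type*} [NormedAddCommGroup E] [InnerProductSpace ℝ E]
  [NormedAddCommGroup F] [InnerProductSpace ℂ F]

/-- The point force `c δ_x`, that is `φ ↦ φ(x) c`. -/
def pointForce (x : E) (c : F) : 𝓢'(E, F) :=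
  ContinuousLinearMap.toPointwiseConvergenceCLM _ _ _ _ <|
    ((BoundedContinuousFunction.evalCLM ℂ x).comp
      (SchwartzMap.toBoundedContinuousFunctionCLM ℂ E ℂ)).smulRight c

@[simp]
theorem pointForce_apply (x : E) (c : F) (φ : 𝓢(E, ℂ)) : pointForce x c φ = φ x • c := rfl

theorem continuousOn_of_hasUnitSpeedOn {γ : ℝ → E} {s : Set ℝ} (h : HasUnitSpeedOn γ s) :
    ContinuousOn γ s := by
  have key : ∀ x ∈ s, ∀ y ∈ s, x ≤ y → edist (γ x) (γ y) ≤ edist x y := by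
    intro x hx y hy hxy
    refine (eVariationOn.edist_le γ (s := s ∩ Icc x y) ⟨hx, le_rfl, hxy⟩ ⟨hy, hxy, le_rfl⟩).trans ?_
    rw [h hx hy, edist_dist, dist_comm, Real.dist_eq, abs_of_nonneg (sub_nonneg.mpr hxy)]
    simp
  have : LipschitzOnWith 1 γ s := by
    intro x hx y hy
    rw [ENNReal.coe_one, one_mul]
    rcases le_total x y with hxy | hxy
    · exact key x hx y hy hxy
    · rw [edist_comm, edist_comm x y]
      exact key y hy x hx hxy
  exact this.continuousOn

theorem intervalIntegrable_smul {L : ℝ} (hL : 0 < L) {γ : ℝ → E}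
    (hγ : HasUnitSpeedOn γ (Icc 0 L)) {f : ℝ → F} (hf : IntervalIntegrable f volume 0 L)
    (φ : BoundedContinuousFunction E ℂ) :
    IntervalIntegrable (fun t => φ (γ t) • f t) volume 0 L := by
  refine hf.continuousOn_smul ?_
  rw [uIcc_of_le hL.le]
  exact φ.continuous.comp_continuousOn (continuousOn_of_hasUnitSpeedOn hγ)

/-- The line force carried by the curve `γ : [0, L] → E`, parametrized by arc length, with the
integrable density `f` (force per unit length): `φ ↦ ∫₀ᴸ φ(γ(t)) f(t) dt`. -/
def lineForce {L : ℝ} (hL : 0 < L) {γ : ℝ → E} (hγ : HasUnitSpeedOn γ (Icc 0 L))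
    {f : ℝ → F} (hf : IntervalIntegrable f volume 0 L) : 𝓢'(E, F) :=
  ContinuousLinearMap.toPointwiseConvergenceCLM _ _ _ _ <|
    (LinearMap.mkContinuous
      (E := BoundedContinuousFunction E ℂ) (F := F) (σ := RingHom.id ℂ)
      { toFun := fun φ => ∫ t in (0 : ℝ)..L, φ (γ t) • f t
        map_add' := fun φ ψ => by
          simp only [BoundedContinuousFunction.coe_add, Pi.add_apply, add_smul]
          exact intervalIntegral.integral_add (intervalIntegrable_smul hL hγ hf φ)
            (intervalIntegrable_smul hL hγ hf ψ)
        map_smul' := fun a φ => by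
          simp only [BoundedContinuousFunction.coe_smul, smul_assoc, RingHom.id_apply]
          exact intervalIntegral.integral_smul _ _ }
      (∫ t in (0 : ℝ)..L, ‖f t‖)
      (fun φ => by
        refine (intervalIntegral.norm_integral_le_of_norm_le hL.le
          (g := fun t => ‖f t‖ * ‖φ‖) ?_ (hf.norm.mul_const _)).trans_eq ?_
        · refine Eventually.of_forall fun t _ => ?_
          rw [norm_smul, mul_comm]
          exact mul_le_mul_of_nonneg_left (φ.norm_coe_le_norm _) (norm_nonneg _)
        · exact intervalIntegral.integral_mul_const _ _)).comp
      (SchwartzMap.toBoundedContinuousFunctionCLM ℂ E ℂ)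

@[simp]
theorem lineForce_apply {L : ℝ} (hL : 0 < L) {γ : ℝ → E} (hγ : HasUnitSpeedOn γ (Icc 0 L))
    {f : ℝ → F} (hf : IntervalIntegrable f volume 0 L) (φ : 𝓢(E, ℂ)) :
    lineForce hL hγ hf φ = ∫ t in (0 : ℝ)..L, φ (γ t) • f t := rfl

/-- `t 0, …, t (N - 1)` are the parameters of `N` points spread uniformly along a curve of length
`L`: one in each of the `N` consecutive arcs of length `L / N`. -/
def UniformlySpread (L : ℝ) (N : ℕ) (t : Fin N → ℝ) : Prop :=
  ∀ i : Fin N, t i ∈ Icc ((i : ℝ) * L / N) (((i : ℝ) + 1) * L / N)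

/-- The total force `∫ f` on the `i`-th of the `N` consecutive arcs of length `L / N`. -/
def arcWeight (L : ℝ) (f : ℝ → F) (N : ℕ) (i : Fin N) : F :=
  ∫ r in ((i : ℝ) * L / N)..(((i : ℝ) + 1) * L / N), f r

/-- The Riemann weight `(L / N) f(t i)`. -/
def riemannWeight (L : ℝ) (f : ℝ → F) (N : ℕ) (t : Fin N → ℝ) (i : Fin N) : F :=
  ((L / N : ℝ) : ℂ) • f (t i)

/-- The sum of point forces `∑ i, c i δ_{γ (t i)}`. -/
def pointForces (γ : ℝ → E) (N : ℕ) (t : Fin N → ℝ) (c : Fin N → F) : 𝓢'(E, F) :=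
  ∑ i : Fin N, pointForce (γ (t i)) (c i)

theorem intervalIntegrable_of_continuousOn {L : ℝ} (hL : 0 < L) {f : ℝ → F}
    (hf : ContinuousOn f (Icc 0 L)) : IntervalIntegrable f volume 0 L :=
  ContinuousOn.intervalIntegrable (by rwa [uIcc_of_le hL.le])

end Forces

end LineForce

end

/-!
The proof takes place on the Fourier side. The Fourier transform of the line force is the bounded
function `h ξ = ∫₀ᴸ e^(-2πi⟨γ(t), ξ⟩) f(t) dt`, that of the point forces is the trigonometric sum
`h_N ξ = ∑ᵢ e^(-2πi⟨γ(tᵢ), ξ⟩) cᵢ`, and by Plancherel the `H^σ` norm of a distribution with bounded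
Fourier transform is the `L²` norm of that transform against the weight `(1 + |ξ|²)^(σ/2)`
(`HasBoundedFourier.sobolevENorm_eq`). In dimension at most three the weight is square integrable
as soon as `σ < -3/2`, so every distribution in question lies in `H^(-3/2-s)`.

For fixed `ξ`, `h_N ξ` is a quadrature of the integral `h ξ` with one node in each arc of length
`L / N` (`norm_integral_sub_sum_arcs_le`). Three bounds on `h - h_N` follow.

* It is bounded uniformly in `N` and `ξ`, and tends to zero pointwise. By dominated convergence
  the distributions converge in the norm of `H^(-3/2-s)`, in particular weakly
  (`tendstoWeaklySobolev_of_tendsto_fourier`).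
* Since `γ` is `1`-Lipschitz, the plane wave `t ↦ e^(-2πi⟨γ(t), ξ⟩)` is `2π|ξ|`-Lipschitz, whence
  `‖h ξ - h_N ξ‖ ≤ (D / N) (1 + |ξ|²)^(1/2)`. The growing factor is absorbed by one more derivative,
  which gives the rate `1 / N` in `H^(-5/2-s)`.
* The geometric mean of the uniform and the Lipschitz bound is `O(N^(-1/2) (1 + |ξ|²)^(1/4))`; half a
  derivative absorbs the growth and the rate is `1 / √N` in `H^(-2-s)`
  (`HasBoundedFourier.sobolevENorm_rates`).
-/

noncomputable section

namespace LineForce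

open FourierTransform

/-! ### Sobolev norms of distributions with a bounded Fourier transform -/

section Weight

variable {E : Type*} [NormedAddCommGroup E]

/-- The multiplier `(1 + |ξ|²)^(σ/2)` of the Bessel potential of order `σ`. -/
def besselWeight (σ : ℝ) (ξ : E) : ℝ := (1 + ‖ξ‖ ^ 2) ^ (σ / 2)

theorem besselWeight_nonneg (σ : ℝ) (ξ : E) : 0 ≤ besselWeight σ ξ := by
  unfold besselWeight; positivity

theorem besselWeight_add (σ τ : ℝ) (ξ : E) :
    besselWeight (σ + τ) ξ = besselWeight σ ξ * besselWeight τ ξ := by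
  unfold besselWeight
  rw [← Real.rpow_add (by positivity)]
  congr 1; ring

theorem continuous_besselWeight (σ : ℝ) : Continuous (besselWeight σ : E → ℝ) :=
  Continuous.rpow_const (by fun_prop) fun ξ => Or.inl (by positivity)

theorem one_le_besselWeight_one (ξ : E) : 1 ≤ besselWeight 1 ξ :=
  Real.one_le_rpow (by nlinarith [sq_nonneg ‖ξ‖]) (by norm_num)

theorem norm_le_besselWeight_one (ξ : E) : ‖ξ‖ ≤ besselWeight 1 ξ := by
  rw [besselWeight, ← Real.sqrt_eq_rpow]
  exact Real.le_sqrt_of_sq_le (by linarith)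

end Weight

section FourierTransformRepresentation

variable {E F : Type*} [NormedAddCommGroup E] [InnerProductSpace ℝ E] [FiniteDimensional ℝ E]
  [MeasurableSpace E] [BorelSpace E]
  [NormedAddCommGroup F] [InnerProductSpace ℂ F]

/-- The distributional Fourier transform of `T` is integration against the bounded measurable
function `h`. The function is recorded rather than its class modulo null sets, so that pointwise
bounds on it can be used directly. -/
structure HasBoundedFourier (T : 𝓢'(E, F)) (h : E → F) : Prop where
  aestronglyMeasurable : AEStronglyMeasurable h volume
  exists_bound : ∃ C, ∀ ξ, ‖h ξ‖ ≤ C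
  fourier_apply : ∀ φ : 𝓢(E, ℂ), 𝓕 T φ = ∫ ξ, φ ξ • h ξ

theorem HasBoundedFourier.integrable_smul {T : 𝓢'(E, F)} {h : E → F} (hT : HasBoundedFourier T h)
    (φ : 𝓢(E, ℂ)) : Integrable (fun ξ => φ ξ • h ξ) := by
  obtain ⟨C, hC⟩ := hT.exists_bound
  exact φ.integrable.smul_bdd C hT.aestronglyMeasurable (ae_of_all _ hC)

theorem HasBoundedFourier.sub {T S : 𝓢'(E, F)} {g h : E → F} (hT : HasBoundedFourier T g)
    (hS : HasBoundedFourier S h) : HasBoundedFourier (T - S) (fun ξ => g ξ - h ξ) where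
  aestronglyMeasurable := hT.aestronglyMeasurable.sub hS.aestronglyMeasurable
  exists_bound := by
    obtain ⟨C, hC⟩ := hT.exists_bound
    obtain ⟨D, hD⟩ := hS.exists_bound
    exact ⟨C + D, fun ξ => (norm_sub_le _ _).trans (add_le_add (hC ξ) (hD ξ))⟩
  fourier_apply φ := by
    simp only [smul_sub]
    rw [integral_sub (hT.integrable_smul φ) (hS.integrable_smul φ), ← hT.fourier_apply,
      ← hS.fourier_apply]
    rfl

theorem HasBoundedFourier.sum {ι : Type*} (s : Finset ι) {T : ι → 𝓢'(E, F)} {h : ι → E → F}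
    (hT : ∀ i, HasBoundedFourier (T i) (h i)) :
    HasBoundedFourier (∑ i ∈ s, T i) (fun ξ => ∑ i ∈ s, h i ξ) where
  aestronglyMeasurable :=
    Finset.aestronglyMeasurable_fun_sum s fun i _ => (hT i).aestronglyMeasurable
  exists_bound := by
    choose C hC using fun i => (hT i).exists_bound
    exact ⟨∑ i ∈ s, C i, fun ξ => norm_sum_le_of_le s fun i _ => hC i ξ⟩
  fourier_apply φ := by
    simp only [Finset.smul_sum]
    rw [integral_finsetSum s fun i _ => (hT i).integrable_smul φ,
      TemperedDistribution.fourier_apply, sum_apply]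
    exact Finset.sum_congr rfl fun i _ => (hT i).fourier_apply φ

theorem memLp_besselWeight {σ : ℝ} (hσ : (Module.finrank ℝ E : ℝ) < -2 * σ) :
    MemLp (besselWeight σ : E → ℝ) 2 := by
  rw [memLp_two_iff_integrable_sq (continuous_besselWeight σ).aestronglyMeasurable]
  refine (integrable_rpow_neg_one_add_norm_sq hσ).congr (ae_of_all _ fun ξ => ?_)
  simp only [besselWeight]
  rw [← Real.rpow_mul_natCast (by positivity)]
  congr 1; push_cast; ring

theorem HasBoundedFourier.memLp {T : 𝓢'(E, F)} {h : E → F} (hT : HasBoundedFourier T h)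
    {σ : ℝ} (hσ : (Module.finrank ℝ E : ℝ) < -2 * σ) :
    MemLp (fun ξ => (besselWeight σ ξ : ℂ) • h ξ) 2 := by
  obtain ⟨C, hC⟩ := hT.exists_bound
  refine (memLp_besselWeight hσ).of_le_mul (c := C) (AEStronglyMeasurable.smul ?_
    hT.aestronglyMeasurable) (ae_of_all _ fun ξ => ?_)
  · exact (Complex.continuous_ofReal.comp (continuous_besselWeight σ)).aestronglyMeasurable
  · rw [norm_smul, Complex.norm_real, mul_comm]
    exact mul_le_mul_of_nonneg_right (hC ξ) (norm_nonneg _)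

/-- The Bessel potential of `T` is the inverse `L²` Fourier transform of the weighted Fourier
transform of `T`. -/
theorem HasBoundedFourier.besselPotential_eq [CompleteSpace F] {T : 𝓢'(E, F)} {h : E → F}
    (hT : HasBoundedFourier T h) {σ : ℝ}
    (hL : MemLp (fun ξ => (besselWeight σ ξ : ℂ) • h ξ) 2) :
    TemperedDistribution.besselPotential E F σ T =
      ((𝓕⁻ (hL.toLp _) : Lp F 2 (volume : Measure E)) : 𝓢'(E, F)) := by
  rw [← Lp.fourierInv_toTemperedDistribution_eq, TemperedDistribution.besselPotential,
    TemperedDistribution.fourierMultiplierCLM_apply]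
  congr 1
  ext φ
  rw [TemperedDistribution.smulLeftCLM_apply_apply, hT.fourier_apply,
    Lp.toTemperedDistribution_apply]
  refine integral_congr_ae ?_
  filter_upwards [hL.coeFn_toLp] with ξ hξ
  rw [hξ, SchwartzMap.smulLeftCLM_apply_apply (by fun_prop), smul_smul, smul_eq_mul, mul_comm]
  rfl

/-- Plancherel's theorem for the Sobolev norm. -/
theorem HasBoundedFourier.sobolevENorm_eq [CompleteSpace F] {T : 𝓢'(E, F)} {h : E → F}
    (hT : HasBoundedFourier T h) {σ : ℝ}
    (hL : MemLp (fun ξ => (besselWeight σ ξ : ℂ) • h ξ) 2) :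
    sobolevENorm σ T = eLpNorm (fun ξ => (besselWeight σ ξ : ℂ) • h ξ) 2 volume := by
  rw [LineForce.sobolevENorm_eq (hT.besselPotential_eq hL), ← Lp.enorm_toLp hL]
  exact (Lp.fourierTransformₗᵢ E F).symm.toLinearIsometry.enorm_map _

/-- A Fourier transform of size `O((1 + |ξ|²)^(a/2))` costs `a` derivatives in the Sobolev norm. -/
theorem HasBoundedFourier.sobolevENorm_le [CompleteSpace F] {T : 𝓢'(E, F)} {h : E → F}
    (hT : HasBoundedFourier T h) {σ a A : ℝ} (hσ : (Module.finrank ℝ E : ℝ) < -2 * (σ + a))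
    (ha : 0 ≤ a) (hA : ∀ ξ, ‖h ξ‖ ≤ A * besselWeight a ξ) :
    sobolevENorm σ T ≤
      ENNReal.ofReal A * eLpNorm (besselWeight (σ + a) : E → ℝ) 2 volume := by
  rw [hT.sobolevENorm_eq (hT.memLp (by linarith))]
  refine eLpNorm_le_mul_eLpNorm_of_ae_le_mul (ae_of_all _ fun ξ => ?_) _
  rw [norm_smul, Complex.norm_real, besselWeight_add, norm_mul,
    Real.norm_of_nonneg (besselWeight_nonneg a ξ)]
  calc _ ≤ ‖besselWeight σ ξ‖ * (A * besselWeight a ξ) := by gcongr; exact hA ξ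
    _ = _ := by ring

/-- Bounded pointwise convergence of the Fourier transforms gives, by dominated convergence, even
norm convergence in `H^σ` for every `σ < -dim E / 2`. -/
theorem tendstoWeaklySobolev_of_tendsto_fourier [CompleteSpace F] {T : ℕ → 𝓢'(E, F)}
    {S : 𝓢'(E, F)} {h : ℕ → E → F} {g : E → F} (hT : ∀ N, HasBoundedFourier (T N) (h N))
    (hS : HasBoundedFourier S g) {σ M : ℝ} (hσ : (Module.finrank ℝ E : ℝ) < -2 * σ)
    (hM : ∀ᶠ N in atTop, ∀ ξ, ‖g ξ - h N ξ‖ ≤ M)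
    (hlim : ∀ ξ, Tendsto (fun N => h N ξ) atTop (𝓝 (g ξ))) :
    TendstoWeaklySobolev σ T S := by
  refine ⟨_, _, fun N => (hT N).besselPotential_eq ((hT N).memLp hσ),
    hS.besselPotential_eq (hS.memLp hσ), fun ℓ => (ℓ.continuous.tendsto _).comp ?_⟩
  refine ((Lp.fourierTransformₗᵢ E F).symm.continuous.tendsto _).comp ?_
  rw [Lp.tendsto_Lp_iff_tendsto_eLpNorm'' _ (fun N => (hT N).memLp hσ)]
  have hw := memLp_besselWeight hσ
  have hsq : Tendsto (fun N => ∫⁻ ξ : E, ‖(besselWeight σ ξ : ℂ) • h N ξ -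
      (besselWeight σ ξ : ℂ) • g ξ‖ₑ ^ (2 : ℝ)) atTop (𝓝 (∫⁻ _ : E, 0)) := by
    refine tendsto_lintegral_filter_of_dominated_convergence'
      (fun ξ => (‖besselWeight σ ξ‖ₑ * ENNReal.ofReal M) ^ (2 : ℝ)) ?_ ?_ ?_ ?_
    · refine Eventually.of_forall fun N => AEMeasurable.pow_const ?_ _
      exact (((hT N).memLp hσ).1.sub (hS.memLp hσ).1).enorm
    · filter_upwards [hM] with N hN
      refine ae_of_all _ fun ξ => ENNReal.rpow_le_rpow ?_ (by norm_num)
      rw [← smul_sub, enorm_smul, ← ofReal_norm (_ - _), norm_sub_rev]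
      refine mul_le_mul' (le_of_eq ?_) (ENNReal.ofReal_le_ofReal (hN ξ))
      rw [← ofReal_norm, ← ofReal_norm, Complex.norm_real]
    · simp_rw [ENNReal.mul_rpow_of_nonneg _ _ (zero_le_two (α := ℝ))]
      rw [lintegral_mul_const'' _ (hw.1.enorm.pow_const _)]
      refine (ENNReal.mul_lt_top ?_ (by finiteness)).ne
      have := lintegral_rpow_enorm_lt_top_of_eLpNorm_lt_top (by norm_num) (by norm_num) hw.2
      simpa using this
    · refine ae_of_all _ fun ξ => ?_
      have h1 : Tendsto (fun N => (besselWeight σ ξ : ℂ) • h N ξ - (besselWeight σ ξ : ℂ) • g ξ)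
          atTop (𝓝 0) := by
        simpa using ((hlim ξ).const_smul (besselWeight σ ξ : ℂ)).sub_const
          ((besselWeight σ ξ : ℂ) • g ξ)
      have h2 := (ENNReal.continuous_rpow_const (y := 2)).tendsto 0 |>.comp
        (by simpa using h1.enorm)
      simpa [Function.comp_def] using h2
  have := (ENNReal.continuous_rpow_const (y := 1 / 2)).tendsto 0 |>.comp
    (by simpa using hsq)
  simpa [Function.comp_def, eLpNorm_eq_lintegral_rpow_enorm_toReal] using this

end FourierTransformRepresentation

/-! ### Fourier transforms of point forces and line forces -/

section Transforms

variable {E F : Type*} [NormedAddCommGroup E] [InnerProductSpace ℝ E]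
  [NormedAddCommGroup F] [InnerProductSpace ℂ F]

/-- The plane wave `e^(-2πi⟨x, ξ⟩)`, as a function of `ξ` the Fourier transform of the Dirac mass at
`x`. The factor `2π` is that of Mathlib's Fourier transform. -/
def planeWave (x ξ : E) : ℂ := Real.fourierChar (-inner ℝ x ξ)

@[simp]
theorem norm_planeWave (x ξ : E) : ‖planeWave x ξ‖ = 1 := Circle.norm_coe _

@[fun_prop]
theorem continuous_uncurry_planeWave : Continuous fun p : E × E => planeWave p.1 p.2 := by
  unfold planeWave; fun_prop

theorem norm_planeWave_sub_le (x y ξ : E) :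
    ‖planeWave x ξ - planeWave y ξ‖ ≤ 2 * Real.pi * ‖ξ‖ * dist x y := by
  have h1 : planeWave x ξ - planeWave y ξ = planeWave y ξ *
      (Complex.exp (Complex.I * (2 * Real.pi * -inner ℝ (x - y) ξ : ℝ)) - 1) := by
    have : planeWave x ξ = planeWave y ξ *
      Complex.exp (Complex.I * (2 * Real.pi * -inner ℝ (x - y) ξ : ℝ)) := by
      simp only [planeWave, Real.fourierChar_apply]
      rw [← Complex.exp_add, inner_sub_left]
      congr 1; push_cast; ring
    rw [this]; ring
  rw [h1, norm_mul, norm_planeWave, one_mul]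
  refine Real.norm_exp_I_mul_ofReal_sub_one_le.trans ?_
  rw [norm_mul, norm_neg, Real.norm_of_nonneg Real.two_pi_pos.le, dist_eq_norm]
  have := norm_inner_le_norm (𝕜 := ℝ) (x - y) ξ
  calc _ ≤ 2 * Real.pi * (‖x - y‖ * ‖ξ‖) := by gcongr
    _ = _ := by ring

variable [FiniteDimensional ℝ E] [MeasurableSpace E] [BorelSpace E]

theorem schwartz_fourier_eq (φ : 𝓢(E, ℂ)) (x : E) :
    𝓕 φ x = ∫ ξ, planeWave x ξ * φ ξ := by
  rw [SchwartzMap.fourier_coe, Real.fourier_eq]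
  refine integral_congr_ae (ae_of_all _ fun ξ => ?_)
  simp only [planeWave, Circle.smul_def, smul_eq_mul, real_inner_comm]

variable [CompleteSpace F]

theorem hasBoundedFourier_pointForce (x : E) (c : F) :
    HasBoundedFourier (pointForce x c) (fun ξ => planeWave x ξ • c) where
  aestronglyMeasurable := by
    refine Continuous.aestronglyMeasurable ?_
    have : Continuous fun ξ : E => planeWave x ξ :=
      continuous_uncurry_planeWave.comp (by fun_prop : Continuous fun ξ : E => (x, ξ))
    exact this.smul continuous_const
  exists_bound := ⟨‖c‖, fun ξ => by simp [norm_smul]⟩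
  fourier_apply φ := by
    rw [TemperedDistribution.fourier_apply, pointForce_apply, schwartz_fourier_eq,
      ← integral_smul_const]
    refine integral_congr_ae (ae_of_all _ fun ξ => ?_)
    simp only [smul_smul, mul_comm]

theorem hasBoundedFourier_pointForces (γ : ℝ → E) (N : ℕ) (t : Fin N → ℝ) (c : Fin N → F) :
    HasBoundedFourier (pointForces γ N t c) (fun ξ => ∑ i, planeWave (γ (t i)) ξ • c i) :=
  HasBoundedFourier.sum _ fun i => hasBoundedFourier_pointForce (γ (t i)) (c i)

/-- By Fubini's theorem, the Fourier transform of the line force is the superposition of the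
transforms of its point masses. -/
theorem hasBoundedFourier_lineForce {L : ℝ} (hL : 0 < L) {γ : ℝ → E}
    (hγ : HasUnitSpeedOn γ (Icc 0 L)) {f : ℝ → F} (hf : IntervalIntegrable f volume 0 L) :
    HasBoundedFourier (lineForce hL hγ hf)
      (fun ξ => ∫ t in (0 : ℝ)..L, planeWave (γ t) ξ • f t) := by
  -- Off `[0, L]` the curve is arbitrary; a continuous extension settles all measurability.
  obtain ⟨η, hη, hηγ⟩ : ∃ η : ℝ → E, Continuous η ∧ ∀ t ∈ Icc 0 L, η t = γ t :=
    ⟨IccExtend hL.le ((Icc 0 L).domRestrict γ),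
      (continuousOn_of_hasUnitSpeedOn hγ).domRestrict.Icc_extend',
      fun t ht => IccExtend_of_mem _ _ ht⟩
  have heq : ∀ ξ, ∫ t in (0 : ℝ)..L, planeWave (γ t) ξ • f t =
      ∫ t in Ioc 0 L, planeWave (η t) ξ • f t := by
    intro ξ
    rw [intervalIntegral.integral_of_le hL.le]
    exact setIntegral_congr_fun measurableSet_Ioc fun t ht => by
      simp only [hηγ t (Ioc_subset_Icc_self ht)]
  have hfi : Integrable f (volume.restrict (Ioc 0 L)) := hf.1
  have hw : Continuous fun p : E × ℝ => planeWave (η p.2) p.1 :=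
    continuous_uncurry_planeWave.comp (by fun_prop : Continuous fun p : E × ℝ => (η p.2, p.1))
  simp_rw [heq]
  refine ⟨?_, ⟨∫ t in Ioc 0 L, ‖f t‖, fun ξ => ?_⟩, fun φ => ?_⟩
  · refine AEStronglyMeasurable.integral_prod_right' (f := fun p : E × ℝ =>
      planeWave (η p.2) p.1 • f p.2) ?_
    exact hw.aestronglyMeasurable.smul hfi.1.comp_snd
  · refine (norm_integral_le_integral_norm _).trans_eq ?_
    simp [norm_smul]
  · have hint : Integrable (Function.uncurry fun (ξ : E) (t : ℝ) =>
        φ ξ • planeWave (η t) ξ • f t) (volume.prod (volume.restrict (Ioc 0 L))) := by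
      have h1 := φ.integrable (μ := volume) |>.smul_prod hfi
      refine (h1.bdd_smul 1 hw.aestronglyMeasurable (ae_of_all _ fun p => by simp)).congr
        (ae_of_all _ fun p => ?_)
      simp only [Function.uncurry, Pi.smul_apply', smul_smul, mul_comm]
    rw [TemperedDistribution.fourier_apply, lineForce_apply,
      intervalIntegral.integral_of_le hL.le]
    simp_rw [← integral_smul]
    rw [integral_integral_swap hint]
    refine setIntegral_congr_fun measurableSet_Ioc fun t ht => ?_
    simp only [schwartz_fourier_eq, ← hηγ t (Ioc_subset_Icc_self ht), ← integral_smul_const,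
      smul_smul, mul_comm]

end Transforms

/-! ### Quadrature on consecutive arcs -/

section Quadrature

variable {E F : Type*} [NormedAddCommGroup E] [InnerProductSpace ℝ E]
  [NormedAddCommGroup F] [InnerProductSpace ℂ F]

theorem dist_le_of_hasUnitSpeedOn {E : Type*} [PseudoMetricSpace E] {γ : ℝ → E} {s : Set ℝ}
    (h : HasUnitSpeedOn γ s) {x y : ℝ} (hx : x ∈ s) (hy : y ∈ s) :
    dist (γ x) (γ y) ≤ |x - y| := by
  wlog hxy : x ≤ y generalizing x y
  · rw [dist_comm, abs_sub_comm]
    exact this hy hx (le_of_not_ge hxy)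
  have := (eVariationOn.edist_le γ (s := s ∩ Icc x y) ⟨hx, le_rfl, hxy⟩ ⟨hy, hxy, le_rfl⟩)
  rw [h hx hy, NNReal.coe_one, one_mul, edist_dist,
    ENNReal.ofReal_le_ofReal_iff (sub_nonneg.2 hxy)] at this
  rwa [abs_sub_comm, abs_of_nonneg (sub_nonneg.2 hxy)]

theorem arc_subset {L : ℝ} (hL : 0 < L) {N : ℕ} (i : Fin N) :
    Icc ((i : ℝ) * L / N) (((i : ℝ) + 1) * L / N) ⊆ Icc 0 L := by
  have hN : (0 : ℝ) < N := by exact_mod_cast i.pos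
  have hi : (i : ℝ) + 1 ≤ N := by exact_mod_cast i.isLt
  refine Icc_subset_Icc (by positivity) ?_
  rw [div_le_iff₀ hN, mul_comm]
  gcongr

theorem arc_le {L : ℝ} (hL : 0 < L) {N : ℕ} (i : Fin N) :
    (i : ℝ) * L / N ≤ ((i : ℝ) + 1) * L / N := by
  gcongr; linarith

theorem abs_sub_le_of_mem_arc {L : ℝ} {N : ℕ} {i : Fin N} {x y : ℝ}
    (hx : x ∈ Icc ((i : ℝ) * L / N) (((i : ℝ) + 1) * L / N))
    (hy : y ∈ Icc ((i : ℝ) * L / N) (((i : ℝ) + 1) * L / N)) : |x - y| ≤ L / N := by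
  have h : ((i : ℝ) + 1) * L / N - (i : ℝ) * L / N = L / N := by ring
  exact (abs_sub_le_iff.2 ⟨by linarith [hx.2, hy.1], by linarith [hy.2, hx.1]⟩)

theorem sum_integral_arcs {L : ℝ} (hL : 0 < L) {N : ℕ} (hN : 1 ≤ N) {G : Type*}
    [NormedAddCommGroup G] [NormedSpace ℝ G] {g : ℝ → G} (hg : IntervalIntegrable g volume 0 L) :
    ∑ i : Fin N, ∫ t in ((i : ℝ) * L / N)..(((i : ℝ) + 1) * L / N), g t =
      ∫ t in (0 : ℝ)..L, g t := by
  have hN' : (N : ℝ) ≠ 0 := by positivity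
  have h := intervalIntegral.sum_integral_adjacent_intervals (f := g) (μ := volume)
    (a := fun k : ℕ => (k : ℝ) * L / N) (n := N) fun k hk => by
      have hs := arc_subset hL ⟨k, hk⟩
      have hle := arc_le hL ⟨k, hk⟩
      refine hg.mono_set ?_
      simp only [Nat.cast_add, Nat.cast_one]
      rwa [uIcc_of_le hle, uIcc_of_le hL.le]
  rw [Finset.sum_range] at h
  simpa [mul_div_cancel_left₀ L hN'] using h

/-- If `g` is approximated by `k i` on the `i`-th arc with pointwise error `b`, then the integral of
`g` is approximated by the sum of the arc integrals of the `k i` with error `∫ b`. -/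
theorem norm_integral_sub_sum_arcs_le {L : ℝ} (hL : 0 < L) {N : ℕ} (hN : 1 ≤ N) {g : ℝ → F}
    (hg : IntervalIntegrable g volume 0 L) {k : Fin N → ℝ → F}
    (hk : ∀ i : Fin N,
      IntervalIntegrable (k i) volume ((i : ℝ) * L / N) (((i : ℝ) + 1) * L / N))
    {b : ℝ → ℝ} (hb : IntervalIntegrable b volume 0 L)
    (h : ∀ i : Fin N, ∀ t ∈ Icc ((i : ℝ) * L / N) (((i : ℝ) + 1) * L / N), ‖g t - k i t‖ ≤ b t) :
    ‖(∫ t in (0 : ℝ)..L, g t) -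
      ∑ i : Fin N, ∫ t in ((i : ℝ) * L / N)..(((i : ℝ) + 1) * L / N), k i t‖ ≤
      ∫ t in (0 : ℝ)..L, b t := by
  have hsub : ∀ i : Fin N, uIcc ((i : ℝ) * L / N) (((i : ℝ) + 1) * L / N) ⊆ uIcc 0 L := by
    intro i
    rw [uIcc_of_le (arc_le hL i), uIcc_of_le hL.le]
    exact arc_subset hL i
  rw [← sum_integral_arcs hL hN hg, ← sum_integral_arcs hL hN hb, ← Finset.sum_sub_distrib]
  refine norm_sum_le_of_le _ fun i _ => ?_
  rw [← intervalIntegral.integral_sub (hg.mono_set (hsub i)) (hk i)]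
  exact intervalIntegral.norm_integral_le_of_norm_le (arc_le hL i)
    (ae_of_all _ fun t ht => h i t (Ioc_subset_Icc_self ht)) (hb.mono_set (hsub i))

theorem continuousOn_planeWave {γ : ℝ → E} {s : Set ℝ} (hγ : HasUnitSpeedOn γ s) (ξ : E) :
    ContinuousOn (fun t => planeWave (γ t) ξ) s := by
  have h : Continuous fun x : E => planeWave x ξ :=
    continuous_uncurry_planeWave.comp (by fun_prop : Continuous fun x : E => (x, ξ))
  exact h.comp_continuousOn (continuousOn_of_hasUnitSpeedOn hγ)

theorem intervalIntegrable_planeWave_smul {L : ℝ} (hL : 0 < L) {γ : ℝ → E}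
    (hγ : HasUnitSpeedOn γ (Icc 0 L)) {f : ℝ → F} (hf : IntervalIntegrable f volume 0 L) (ξ : E) :
    IntervalIntegrable (fun t => planeWave (γ t) ξ • f t) volume 0 L := by
  refine hf.continuousOn_smul ?_
  rw [uIcc_of_le hL.le]
  exact continuousOn_planeWave hγ ξ

/-- With the arc weights only the plane wave is sampled at the nodes, so the density `f` need not
have any regularity. -/
theorem norm_lineTransform_sub_arcWeight_le [CompleteSpace F] {L : ℝ} (hL : 0 < L) {γ : ℝ → E}
    (hγ : HasUnitSpeedOn γ (Icc 0 L)) {f : ℝ → F} (hf : IntervalIntegrable f volume 0 L)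
    {N : ℕ} (hN : 1 ≤ N) (t : Fin N → ℝ) (ξ : E) {ε : ℝ}
    (h : ∀ i : Fin N, ∀ r ∈ Icc ((i : ℝ) * L / N) (((i : ℝ) + 1) * L / N),
      ‖planeWave (γ r) ξ - planeWave (γ (t i)) ξ‖ ≤ ε) :
    ‖(∫ r in (0 : ℝ)..L, planeWave (γ r) ξ • f r) -
      ∑ i, planeWave (γ (t i)) ξ • arcWeight L f N i‖ ≤ ε * ∫ r in (0 : ℝ)..L, ‖f r‖ := by
  have hk : ∀ i : Fin N, IntervalIntegrable (fun r => planeWave (γ (t i)) ξ • f r) volume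
      ((i : ℝ) * L / N) (((i : ℝ) + 1) * L / N) := fun i => by
    refine (hf.mono_set ?_).smul _
    rw [uIcc_of_le (arc_le hL i), uIcc_of_le hL.le]
    exact arc_subset hL i
  have := norm_integral_sub_sum_arcs_le hL hN (intervalIntegrable_planeWave_smul hL hγ hf ξ) hk
    (hf.norm.const_mul ε) fun i r hr => by
      rw [← sub_smul, norm_smul]
      exact mul_le_mul_of_nonneg_right (h i r hr) (norm_nonneg _)
  simpa only [arcWeight, intervalIntegral.integral_smul, intervalIntegral.integral_const_mul]
    using this

/-- With the Riemann weights the whole integrand is sampled at the nodes. -/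
theorem norm_lineTransform_sub_riemannWeight_le [CompleteSpace F] {L : ℝ} (hL : 0 < L) {γ : ℝ → E}
    (hγ : HasUnitSpeedOn γ (Icc 0 L)) {f : ℝ → F} (hf : IntervalIntegrable f volume 0 L)
    {N : ℕ} (hN : 1 ≤ N) (t : Fin N → ℝ) (ξ : E) {ε : ℝ}
    (h : ∀ i : Fin N, ∀ r ∈ Icc ((i : ℝ) * L / N) (((i : ℝ) + 1) * L / N),
      ‖planeWave (γ r) ξ • f r - planeWave (γ (t i)) ξ • f (t i)‖ ≤ ε) :
    ‖(∫ r in (0 : ℝ)..L, planeWave (γ r) ξ • f r) -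
      ∑ i, planeWave (γ (t i)) ξ • riemannWeight L f N t i‖ ≤ L * ε := by
  have := norm_integral_sub_sum_arcs_le hL hN (intervalIntegrable_planeWave_smul hL hγ hf ξ)
    (k := fun i _ => planeWave (γ (t i)) ξ • f (t i)) (fun _ => intervalIntegrable_const)
    (intervalIntegrable_const (c := ε)) h
  simp only [intervalIntegral.integral_const, sub_zero, smul_eq_mul] at this
  convert this using 4 with i
  rw [riemannWeight, smul_comm, Complex.coe_smul]
  congr 1; ring

end Quadrature

/-! ### Rates of convergence -/

section Rates

variable {E F : Type*} [NormedAddCommGroup E] [InnerProductSpace ℝ E] [FiniteDimensional ℝ E]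
  [MeasurableSpace E] [BorelSpace E]
  [NormedAddCommGroup F] [InnerProductSpace ℂ F] [CompleteSpace F]

/-- The rate `N⁻¹` comes from the Lipschitz bound on the Fourier transform, and the rate `N^(-1/2)`
from the geometric mean of that bound and the uniform bound. -/
theorem HasBoundedFourier.sobolevENorm_rates (hE : Module.finrank ℝ E ≤ 3) {s : ℝ} (hs : 0 < s)
    {M D : ℝ} (hM₀ : 0 ≤ M) (hD₀ : 0 ≤ D) :
    ∃ C : ℝ, ∀ (N : ℕ) (T : 𝓢'(E, F)) (h : E → F), HasBoundedFourier T h →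
      (∀ ξ, ‖h ξ‖ ≤ M) → (∀ ξ, ‖h ξ‖ ≤ D / N * besselWeight 1 ξ) →
      sobolevENorm (-2 - s) T ≤ ENNReal.ofReal (C / √N) ∧
      sobolevENorm (-5 / 2 - s) T ≤ ENNReal.ofReal (C / N) := by
  have hE' : (Module.finrank ℝ E : ℝ) ≤ 3 := by exact_mod_cast hE
  set J := (eLpNorm (besselWeight (-3 / 2 - s) : E → ℝ) 2 volume).toReal with hJ
  have hJ' : eLpNorm (besselWeight (-3 / 2 - s) : E → ℝ) 2 volume = ENNReal.ofReal J :=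
    (ENNReal.ofReal_toReal (memLp_besselWeight (by linarith)).2.ne).symm
  have hJ₀ : 0 ≤ J := ENNReal.toReal_nonneg
  -- The two summands are the constants of the two estimates.
  refine ⟨√(M * D) * J + D * J, fun N T h hT hM hD => ⟨?_, ?_⟩⟩
  · have hb : ∀ ξ, ‖h ξ‖ ≤ √(M * D) / √N * besselWeight (1 / 2) ξ := by
      intro ξ
      have hw : besselWeight (1 / 2) ξ ^ 2 = besselWeight 1 ξ := by
        rw [sq, ← besselWeight_add]; norm_num
      refine le_of_sq_le_sq ?_ (mul_nonneg (by positivity) (besselWeight_nonneg _ _))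
      rw [mul_pow, hw, div_pow, Real.sq_sqrt (by positivity), Real.sq_sqrt (by positivity), sq]
      calc _ ≤ M * (D / N * besselWeight 1 ξ) := by gcongr; exacts [hM ξ, hD ξ]
        _ = _ := by ring
    refine (hT.sobolevENorm_le (a := 1 / 2) (by linarith) (by norm_num) hb).trans ?_
    rw [show -2 - s + 1 / 2 = -3 / 2 - s by ring, hJ', ← ENNReal.ofReal_mul (by positivity)]
    refine ENNReal.ofReal_le_ofReal ?_
    rw [div_mul_eq_mul_div]
    gcongr
    linarith [mul_nonneg hD₀ hJ₀]
  · refine (hT.sobolevENorm_le (a := 1) (by linarith) (by norm_num) hD).trans ?_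
    rw [show -5 / 2 - s + 1 = -3 / 2 - s by ring, hJ', ← ENNReal.ofReal_mul (by positivity)]
    refine ENNReal.ofReal_le_ofReal ?_
    rw [div_mul_eq_mul_div]
    gcongr
    linarith [mul_nonneg (Real.sqrt_nonneg (M * D)) hJ₀]

end Rates

/-! ### Convergence for the two choices of forces -/

section Convergence

variable {E F : Type*} [NormedAddCommGroup E] [InnerProductSpace ℝ E]
  [NormedAddCommGroup F] [InnerProductSpace ℂ F]

theorem norm_planeWave_sub_le_of_mem_arc {L : ℝ} (hL : 0 < L) {γ : ℝ → E}
    (hγ : HasUnitSpeedOn γ (Icc 0 L)) (ξ : E) {N : ℕ} {i : Fin N} {r u : ℝ}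
    (hr : r ∈ Icc ((i : ℝ) * L / N) (((i : ℝ) + 1) * L / N))
    (hu : u ∈ Icc ((i : ℝ) * L / N) (((i : ℝ) + 1) * L / N)) :
    ‖planeWave (γ r) ξ - planeWave (γ u) ξ‖ ≤ 2 * Real.pi * ‖ξ‖ * (L / N) := by
  refine (norm_planeWave_sub_le _ _ ξ).trans ?_
  gcongr
  exact (dist_le_of_hasUnitSpeedOn hγ (arc_subset hL i hr) (arc_subset hL i hu)).trans
    (abs_sub_le_of_mem_arc hr hu)

variable [FiniteDimensional ℝ E] [MeasurableSpace E] [BorelSpace E] [CompleteSpace F]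

theorem arcWeight_convergence (hE : Module.finrank ℝ E ≤ 3) {L : ℝ} (hL : 0 < L) {γ : ℝ → E}
    (hγ : HasUnitSpeedOn γ (Icc 0 L)) {s : ℝ} (hs : 0 < s) {f : ℝ → F}
    (hf : IntervalIntegrable f volume 0 L) :
    (∀ t : (N : ℕ) → Fin N → ℝ, (∀ N, UniformlySpread L N (t N)) →
      TendstoWeaklySobolev (-3 / 2 - s)
        (fun N => pointForces γ N (t N) (arcWeight L f N)) (lineForce hL hγ hf)) ∧
    ∃ C : ℝ, ∀ N : ℕ, 1 ≤ N → ∀ t : Fin N → ℝ, UniformlySpread L N t →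
      sobolevENorm (-2 - s) (lineForce hL hγ hf - pointForces γ N t (arcWeight L f N))
          ≤ ENNReal.ofReal (C / √N) ∧
      sobolevENorm (-5 / 2 - s) (lineForce hL hγ hf - pointForces γ N t (arcWeight L f N))
          ≤ ENNReal.ofReal (C / N) := by
  have hE' : (Module.finrank ℝ E : ℝ) ≤ 3 := by exact_mod_cast hE
  set M := ∫ r in (0 : ℝ)..L, ‖f r‖ with hM
  have hM₀ : 0 ≤ M := intervalIntegral.integral_nonneg hL.le fun _ _ => norm_nonneg _
  have h2 : ∀ N : ℕ, 1 ≤ N → ∀ t : Fin N → ℝ, ∀ ξ,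
      ‖(∫ r in (0 : ℝ)..L, planeWave (γ r) ξ • f r) -
        ∑ i, planeWave (γ (t i)) ξ • arcWeight L f N i‖ ≤ 2 * M := fun N hN t ξ =>
    norm_lineTransform_sub_arcWeight_le hL hγ hf hN t ξ fun i r _ =>
      (norm_sub_le _ _).trans (by norm_num)
  have hlip : ∀ N : ℕ, 1 ≤ N → ∀ t : Fin N → ℝ, UniformlySpread L N t → ∀ ξ,
      ‖(∫ r in (0 : ℝ)..L, planeWave (γ r) ξ • f r) -
        ∑ i, planeWave (γ (t i)) ξ • arcWeight L f N i‖ ≤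
        2 * Real.pi * L * M / N * ‖ξ‖ := fun N hN t ht ξ => by
    refine (norm_lineTransform_sub_arcWeight_le hL hγ hf hN t ξ fun i r hr =>
      norm_planeWave_sub_le_of_mem_arc hL hγ ξ hr (ht i)).trans_eq ?_
    ring
  constructor
  · intro t ht
    refine tendstoWeaklySobolev_of_tendsto_fourier (M := 2 * M)
      (fun N => hasBoundedFourier_pointForces γ N (t N) _) (hasBoundedFourier_lineForce hL hγ hf)
      (by linarith) ?_ fun ξ => ?_
    · filter_upwards [eventually_ge_atTop 1] with N hN ξ using h2 N hN (t N) ξ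
    · refine tendsto_iff_norm_sub_tendsto_zero.2 (squeeze_zero' (.of_forall fun _ => norm_nonneg _)
        (g := fun N : ℕ => 2 * Real.pi * L * M / N * ‖ξ‖) ?_ ?_)
      · filter_upwards [eventually_ge_atTop 1] with N hN
        rw [norm_sub_rev]
        exact hlip N hN (t N) (ht N) ξ
      · simpa using (tendsto_const_div_atTop_nhds_zero_nat (2 * Real.pi * L * M)).mul_const ‖ξ‖
  · obtain ⟨C, hC⟩ := HasBoundedFourier.sobolevENorm_rates (E := E) (F := F) hE hs
      (M := 2 * M) (D := 2 * Real.pi * L * M) (by positivity) (by positivity)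
    refine ⟨C, fun N hN t ht => hC N _ _ ((hasBoundedFourier_lineForce hL hγ hf).sub
      (hasBoundedFourier_pointForces γ N t _)) (h2 N hN t) fun ξ => ?_⟩
    refine (hlip N hN t ht ξ).trans ?_
    gcongr
    exact norm_le_besselWeight_one ξ

theorem riemannWeight_convergence (hE : Module.finrank ℝ E ≤ 3) {L : ℝ} (hL : 0 < L) {γ : ℝ → E}
    (hγ : HasUnitSpeedOn γ (Icc 0 L)) {s : ℝ} (hs : 0 < s) {f : ℝ → F}
    (hf : ContinuousOn f (Icc 0 L)) :
    (∀ t : (N : ℕ) → Fin N → ℝ, (∀ N, UniformlySpread L N (t N)) →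
      TendstoWeaklySobolev (-3 / 2 - s)
        (fun N => pointForces γ N (t N) (riemannWeight L f N (t N)))
        (lineForce hL hγ (intervalIntegrable_of_continuousOn hL hf))) ∧
    ((∃ K : NNReal, LipschitzOnWith K f (Icc 0 L)) →
      ∃ C : ℝ, ∀ N : ℕ, 1 ≤ N → ∀ t : Fin N → ℝ, UniformlySpread L N t →
        sobolevENorm (-2 - s) (lineForce hL hγ (intervalIntegrable_of_continuousOn hL hf) -
            pointForces γ N t (riemannWeight L f N t)) ≤ ENNReal.ofReal (C / √N) ∧
        sobolevENorm (-5 / 2 - s) (lineForce hL hγ (intervalIntegrable_of_continuousOn hL hf) -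
            pointForces γ N t (riemannWeight L f N t)) ≤ ENNReal.ofReal (C / N)) := by
  have hE' : (Module.finrank ℝ E : ℝ) ≤ 3 := by exact_mod_cast hE
  have hfi := intervalIntegrable_of_continuousOn hL hf
  obtain ⟨S, hS⟩ := isCompact_Icc.exists_bound_of_continuousOn hf
  have hS₀ : 0 ≤ S := (norm_nonneg _).trans (hS 0 ⟨le_rfl, hL.le⟩)
  have h2 : ∀ N : ℕ, 1 ≤ N → ∀ t : Fin N → ℝ, UniformlySpread L N t → ∀ ξ,
      ‖(∫ r in (0 : ℝ)..L, planeWave (γ r) ξ • f r) -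
        ∑ i, planeWave (γ (t i)) ξ • riemannWeight L f N t i‖ ≤ L * (S + S) :=
    fun N hN t ht ξ => norm_lineTransform_sub_riemannWeight_le hL hγ hfi hN t ξ fun i r hr => by
      refine (norm_sub_le _ _).trans (add_le_add ?_ ?_) <;>
        rw [norm_smul, norm_planeWave, one_mul]
      exacts [hS r (arc_subset hL i hr), hS _ (arc_subset hL i (ht i))]
  constructor
  · intro t ht
    refine tendstoWeaklySobolev_of_tendsto_fourier (M := L * (S + S))
      (fun N => hasBoundedFourier_pointForces γ N (t N) _) (hasBoundedFourier_lineForce hL hγ hfi)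
      (by linarith) ?_ fun ξ => ?_
    · filter_upwards [eventually_ge_atTop 1] with N hN ξ using h2 N hN (t N) (ht N) ξ
    · -- The integrand is uniformly continuous on `[0, L]`, so its Riemann sums converge.
      have hg : UniformContinuousOn (fun r => planeWave (γ r) ξ • f r) (Icc 0 L) :=
        isCompact_Icc.uniformContinuousOn_of_continuous
          ((continuousOn_planeWave hγ ξ).smul hf)
      rw [Metric.tendsto_atTop']
      intro ε hε
      obtain ⟨δ, hδ, hgδ⟩ := Metric.uniformContinuousOn_iff.1 hg (ε / (2 * L)) (by positivity)
      obtain ⟨n, hn⟩ := exists_nat_gt (L / δ)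
      refine ⟨n, fun N hN => ?_⟩
      have hN₀ : 0 < N := by omega
      have hNδ : L / N < δ := by
        rw [div_lt_comm₀ (by exact_mod_cast hN₀) hδ]
        exact hn.trans (by exact_mod_cast hN)
      rw [dist_comm, dist_eq_norm]
      refine (norm_lineTransform_sub_riemannWeight_le hL hγ hfi hN₀ (t N) ξ
        (ε := ε / (2 * L)) fun i r hr => ?_).trans_lt ?_
      · rw [← dist_eq_norm]
        exact (hgδ r (arc_subset hL i hr) _ (arc_subset hL i (ht N i))
          ((abs_sub_le_of_mem_arc hr (ht N i)).trans_lt hNδ)).le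
      · rw [mul_div_assoc', mul_comm 2 L, mul_div_mul_left _ _ hL.ne']
        exact half_lt_self hε
  · rintro ⟨K, hK⟩
    obtain ⟨C, hC⟩ := HasBoundedFourier.sobolevENorm_rates (E := E) (F := F) hE hs
      (M := L * (S + S)) (D := L * ((2 * Real.pi * S + K) * L)) (by positivity) (by positivity)
    refine ⟨C, fun N hN t ht => hC N _ _ ((hasBoundedFourier_lineForce hL hγ hfi).sub
      (hasBoundedFourier_pointForces γ N t _)) (h2 N hN t ht) fun ξ => ?_⟩
    -- Both the plane wave and `f` vary on an arc; as `1 ≤ (1 + |ξ|²)^(1/2)`, the variation of `f`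
    -- is absorbed into the same weight.
    refine (norm_lineTransform_sub_riemannWeight_le hL hγ hfi hN t ξ
      (ε := (2 * Real.pi * S + K) * (L / N) * besselWeight 1 ξ) fun i r hr => ?_).trans_eq
        (by ring)
    have hrL := arc_subset hL i hr
    have htL := arc_subset hL i (ht i)
    have h1 : planeWave (γ r) ξ • f r - planeWave (γ (t i)) ξ • f (t i) =
        (planeWave (γ r) ξ - planeWave (γ (t i)) ξ) • f r +
          planeWave (γ (t i)) ξ • (f r - f (t i)) := by
      rw [sub_smul, smul_sub]; abel
    rw [h1]
    refine (norm_add_le _ _).trans ?_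
    rw [norm_smul, norm_smul, norm_planeWave, one_mul, ← dist_eq_norm (f r)]
    calc _ ≤ 2 * Real.pi * besselWeight 1 ξ * (L / N) * S + K * (L / N) * besselWeight 1 ξ := by
          refine add_le_add ?_ ?_
          · refine mul_le_mul ?_ (hS r hrL) (norm_nonneg _) ?_
            · refine (norm_planeWave_sub_le_of_mem_arc hL hγ ξ hr (ht i)).trans ?_
              gcongr
              exact norm_le_besselWeight_one ξ
            · have := besselWeight_nonneg 1 ξ
              positivity
          · refine (hK.dist_le_mul r hrL _ htL).trans ?_
            rw [mul_assoc]
            refine mul_le_mul_of_nonneg_left ?_ K.coe_nonneg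
            exact (abs_sub_le_of_mem_arc hr (ht i)).trans
              (le_mul_of_one_le_right (by positivity) (one_le_besselWeight_one ξ))
      _ = _ := by ring

end Convergence

end LineForce

end

open LineForce in
theorem mainTheorem1 (d m : ℕ) (hd : d = 2 ∨ d = 3)
    (L : ℝ) (hL : 0 < L) (γ : ℝ → EuclideanSpace ℝ (Fin d)) (hγ : HasUnitSpeedOn γ (Set.Icc 0 L))
    (s : ℝ) (hs : 0 < s) :
    -- integrable density, each point force carrying the total force of its arc
    (∀ (f : ℝ → EuclideanSpace ℂ (Fin m)) (hf : IntervalIntegrable f MeasureTheory.volume 0 L),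
      (∀ t : (N : ℕ) → Fin N → ℝ, (∀ N, UniformlySpread L N (t N)) →
        TendstoWeaklySobolev (-3 / 2 - s)
          (fun N => pointForces γ N (t N) (arcWeight L f N)) (lineForce hL hγ hf)) ∧
      ∃ C : ℝ, ∀ N : ℕ, 1 ≤ N → ∀ t : Fin N → ℝ, UniformlySpread L N t →
        sobolevENorm (-2 - s) (lineForce hL hγ hf - pointForces γ N t (arcWeight L f N))
            ≤ ENNReal.ofReal (C / √N) ∧
        sobolevENorm (-5 / 2 - s) (lineForce hL hγ hf - pointForces γ N t (arcWeight L f N))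
            ≤ ENNReal.ofReal (C / N)) ∧
    -- continuous density, Riemann weights
    (∀ (f : ℝ → EuclideanSpace ℂ (Fin m)) (hf : ContinuousOn f (Set.Icc 0 L)),
      (∀ t : (N : ℕ) → Fin N → ℝ, (∀ N, UniformlySpread L N (t N)) →
        TendstoWeaklySobolev (-3 / 2 - s)
          (fun N => pointForces γ N (t N) (riemannWeight L f N (t N)))
          (lineForce hL hγ (intervalIntegrable_of_continuousOn hL hf))) ∧
      ((∃ K : NNReal, LipschitzOnWith K f (Set.Icc 0 L)) →
        ∃ C : ℝ, ∀ N : ℕ, 1 ≤ N → ∀ t : Fin N → ℝ, UniformlySpread L N t →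
          sobolevENorm (-2 - s) (lineForce hL hγ (intervalIntegrable_of_continuousOn hL hf) -
              pointForces γ N t (riemannWeight L f N t)) ≤ ENNReal.ofReal (C / √N) ∧
          sobolevENorm (-5 / 2 - s) (lineForce hL hγ (intervalIntegrable_of_continuousOn hL hf) -
              pointForces γ N t (riemannWeight L f N t)) ≤ ENNReal.ofReal (C / N))) := by
  have hE : Module.finrank ℝ (EuclideanSpace ℝ (Fin d)) ≤ 3 := by
    rw [finrank_euclideanSpace_fin]; omega
  exact ⟨fun _ hf => arcWeight_convergence hE hL hγ hs hf,
    fun _ hf => riemannWeight_convergence hE hL hγ hs hf⟩
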